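/- Let $K$ be a field, let $n\ge 1$, and let $\mathbf a=(a_1,\dots,a_n)$ be a sequence of nonnegative integers with $\gcd(a_1,\dots,a_n)=1$ and $a_i<a_n$ for all $i<n$. Let $I(\mathbf a)$ be the kernel of the $K$-algebra homomorphism $K[x_1,\dots,x_n]\to K[t]$, $x_i\mapsto t^{a_i}$, and let $I(\mathbf a)^h\subset K[x_0,x_1,\dots,x_n]$ be its homogenization with respect to $x_0$, that is, the homogeneous ideal of the projective monomial curve $\overline{C(\mathbf a)}\subset\mathbb P^n$. The curve $\overline{C(\mathbf a)}$ is called arithmetically Cohen–Macaulay if $K[x_0,\dots,x_n]/I(\mathbf a)^h$ is a Cohen–Macaulay ring. Let $H\subseteq\mathbb N$ be the semigroup (with $0$) generated by $a_1,\dots,a_n$, let $H'\subseteq\mathbb N$ be the one generated by the dual sequence $a_n-a_1,\dots,a_n-a_{n-1},a_n$, and let $\mathcal S\subseteq\mathbb N^2$ be the one generated by $(0,a_n)$ and $(a_i,a_n-a_i)$ for $1\le i\le n$. For $G\in\{H,H'\}$ put $\mathrm{Ap}(G,a_n)=\{x\in G: x-a_n\notin G\}$. Write $\mathrm{Ap}(H,a_n)=\{0,\nu_1,\dots,\nu_{a_n-1}\}$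 with $\nu_i\equiv i \pmod{a_n}$, and for each $i$ let $\mu_i$ be the smallest element of $H'$ with $(\nu_i,\mu_i)\in\mathcal S$. The set $\mathrm{Ap}(H,a_n)$ is called good if $\{0,\mu_1,\dots,\mu_{a_n-1}\}=\mathrm{Ap}(H',a_n)$. Then $\overline{C(\mathbf a)}$ is arithmetically Cohen–Macaulay if and only if $\mathrm{Ap}(H,a_n)$ is good. -/

import Mathlib

/-- The depth of a local ring: the supremum of the lengths of the regular sequences
contained in its maximal ideal. -/
noncomputable def localDepth (R : Type*) [CommRing R] [IsLocalRing R] : ℕ∞ :=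
  ⨆ rs : {rs : List R // RingTheory.Sequence.IsRegular R rs ∧
    ∀ r ∈ rs, r ∈ IsLocalRing.maximalIdeal R}, (rs.1.length : ℕ∞)

/-- A local ring is Cohen-Macaulay if it is Noetherian and its depth equals its Krull dimension. -/
def IsCohenMacaulayLocalRing (R : Type*) [CommRing R] [IsLocalRing R] : Prop :=
  IsNoetherianRing R ∧ (localDepth R : WithBot ℕ∞) = ringKrullDim R

/-- A commutative ring is Cohen-Macaulay if it is Noetherian and its localization at every
maximal ideal is a Cohen-Macaulay local ring. -/
def IsCohenMacaulayRing (R : Type*) [CommRing R] : Prop :=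
  IsNoetherianRing R ∧
    ∀ (m : Ideal R) [m.IsMaximal], IsCohenMacaulayLocalRing (Localization.AtPrime m)

/-- An ideal is called a Cohen-Macaulay ideal if its residue class ring is Cohen-Macaulay. -/
def IsCohenMacaulayIdeal {R : Type*} [CommRing R] (I : Ideal R) : Prop :=
  IsCohenMacaulayRing (R ⧸ I)

/-- The homogenization of a polynomial in `m` variables with respect to a new variable, which
becomes the variable with index `0`; the old variable with index `i` becomes `i.succ`. Each
monomial is multiplied by the power of the new variable that brings its degree up to the
total degree of the polynomial. -/
noncomputable def homogenizePoly {K : Type*} [CommSemiring K] {m : ℕ}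
    (f : MvPolynomial (Fin m) K) : MvPolynomial (Fin (m + 1)) K :=
  ∑ α ∈ f.support, MvPolynomial.monomial (Finsupp.cons (f.totalDegree - α.degree) α) (f.coeff α)

/-- The homogenization of an ideal: the ideal generated by the homogenizations of its elements. -/
noncomputable def homogenizeIdeal {K : Type*} [CommSemiring K] {m : ℕ}
    (I : Ideal (MvPolynomial (Fin m) K)) : Ideal (MvPolynomial (Fin (m + 1)) K) :=
  Ideal.span (homogenizePoly '' (I : Set (MvPolynomial (Fin m) K)))

namespace MonomialCurve

/-- The ideal of the affine monomial curve of `a`: the kernel of the `K`-algebra homomorphism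
from `K[x₁, …, xₘ]` to `K[t]` that sends the `i`-th variable to `t ^ aᵢ`. -/
noncomputable def toricIdeal (K : Type*) [Field K] {m : ℕ} (a : Fin m → ℕ) :
    Ideal (MvPolynomial (Fin m) K) :=
  RingHom.ker
    (MvPolynomial.aeval (R := K) fun i => (Polynomial.X : Polynomial K) ^ a i)

/-- The projective monomial curve of `a`, the projective closure of the affine monomial curve, is
arithmetically Cohen-Macaulay (over `K`) if its homogeneous ideal, the homogenization of the ideal
of the affine curve, is a Cohen-Macaulay ideal. -/
def IsArithmeticallyCohenMacaulay (K : Type*) [Field K] {m : ℕ} (a : Fin m → ℕ) : Prop :=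
  IsCohenMacaulayIdeal (homogenizeIdeal (toricIdeal K a))

/-- The submonoid of `ℕ` generated by the entries of the sequence `a`. -/
def semigroup {m : ℕ} (a : Fin m → ℕ) : AddSubmonoid ℕ :=
  AddSubmonoid.closure (Set.range a)

/-- The dual sequence `aₙ - a₁, …, aₙ - aₙ₋₁, aₙ` of a sequence `a₁, …, aₙ` whose last entry is
its largest one (here `n = k + 1`, and the last entry is `a (Fin.last k)`). -/
def dualSeq {k : ℕ} (a : Fin (k + 1) → ℕ) : Fin (k + 1) → ℕ :=
  fun i => if i = Fin.last k then a (Fin.last k) else a (Fin.last k) - a i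

/-- The Apéry set `{x ∈ H : x - h ∉ H}`, where the difference is taken in the integers. -/
def aperySet (H : AddSubmonoid ℕ) (h : ℕ) : Set ℕ :=
  {x | x ∈ H ∧ ∀ y ∈ H, y + h ≠ x}

/-- The submonoid of `ℕ²` generated by `(0, aₙ)` and the pairs `(aᵢ, aₙ - aᵢ)`, `i = 1, …, n`
(the last of these is `(aₙ, 0)`). -/
def projSemigroup {k : ℕ} (a : Fin (k + 1) → ℕ) : AddSubmonoid (ℕ × ℕ) :=
  AddSubmonoid.closure
    (insert (0, a (Fin.last k)) (Set.range fun i => (a i, a (Fin.last k) - a i)))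

/-- `μ` is the smallest element of `H'`, the semigroup of the dual sequence, such that `(ν, μ)`
lies in the semigroup of the projective curve. -/
def IsMinimalPartner {k : ℕ} (a : Fin (k + 1) → ℕ) (ν μ : ℕ) : Prop :=
  IsLeast {y : ℕ | y ∈ semigroup (dualSeq a) ∧ (ν, y) ∈ projSemigroup a} μ

/-- The Apéry set of `H` with respect to `aₙ` is good if the minimal partners of its nonzero
elements, together with `0`, are exactly the elements of the Apéry set of `H'` with respect
to `aₙ`. -/
def AperySetIsGood {k : ℕ} (a : Fin (k + 1) → ℕ) : Prop :=
  insert 0 {μ : ℕ | ∃ ν ∈ aperySet (semigroup a) (a (Fin.last k)), ν ≠ 0 ∧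
      IsMinimalPartner a ν μ} =
    aperySet (semigroup (dualSeq a)) (a (Fin.last k))

end MonomialCurve

/-! Both sides are equivalent to saturation of the projective semigroup S: every `(x, y)` with `x ∈
H`, `y ∈ H'` and `aₙ ∣ x + y` lies in S. For goodness this is `aperySetIsGood_iff`: modulo multiples
of the two axis generators, only pairs of Apéry elements in opposite residue classes matter.

On the algebraic side, `homogenizeIdeal_toricIdeal` identifies the coordinate ring with the span R
of the monomials with exponent in S, inside `K[X][X]`. A pair satisfying the saturation hypotheses
enters S after adding enough of either axis generator. If it is not in S itself, it gives an element
that is nonzero modulo a power of `xₙ` but killed there by powers of `x₀` and `xₙ`. An associated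
prime then contains both axis coordinates, hence is the vertex ideal, where the depth is at most 1
and the height at least 2 (`mem_projSemigroup_of_isCohenMacaulayRing`).

Conversely, the Cohen-Macaulay property is needed at every maximal ideal, not only at the vertex.
Each contains monic polynomials `g(xₙ)` and `h(x₀)`; under saturation they form a regular sequence
(`dvd_of_dvd_aeval_mul`), and the ideal is minimal over them, so its height is at most 2. -/

namespace MonomialCurve

/-! ### Goodness of the Apéry set as saturation of the semigroup. -/

section Combinatorics

variable {k : ℕ} {a : Fin (k + 1) → ℕ}

lemma last_pos (hgcd : Finset.univ.gcd a = 1)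
    (hlast : ∀ i, i ≠ Fin.last k → a i < a (Fin.last k)) : 0 < a (Fin.last k) := by
  rcases Nat.eq_zero_or_pos (a (Fin.last k)) with h | h
  · exfalso
    have h0 : Finset.univ.gcd a = 0 := by
      rw [Finset.gcd_eq_zero_iff]
      intro i _
      by_cases hi : i = Fin.last k
      · rw [hi, h]
      · exact absurd (hlast i hi) (by omega)
    omega
  · exact h

lemma le_last (hlast : ∀ i, i ≠ Fin.last k → a i < a (Fin.last k)) (i : Fin (k + 1)) :
    a i ≤ a (Fin.last k) := by
  by_cases hi : i = Fin.last k
  · rw [hi]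
  · exact (hlast i hi).le

lemma axis_snd_mem : ((0, a (Fin.last k)) : ℕ × ℕ) ∈ projSemigroup a :=
  AddSubmonoid.subset_closure (Set.mem_insert _ _)

lemma gen_mem (i : Fin (k + 1)) : (a i, a (Fin.last k) - a i) ∈ projSemigroup a :=
  AddSubmonoid.subset_closure (Set.mem_insert_of_mem _ ⟨i, rfl⟩)

lemma axis_fst_mem : ((a (Fin.last k), 0) : ℕ × ℕ) ∈ projSemigroup a := by
  simpa using gen_mem (a := a) (Fin.last k)

lemma nsmul_axis_fst_mem (n : ℕ) : ((n * a (Fin.last k), 0) : ℕ × ℕ) ∈ projSemigroup a := by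
  simpa using (projSemigroup a).nsmul_mem axis_fst_mem n

lemma nsmul_axis_snd_mem (n : ℕ) : ((0, n * a (Fin.last k)) : ℕ × ℕ) ∈ projSemigroup a := by
  simpa using (projSemigroup a).nsmul_mem axis_snd_mem n

lemma last_mem_semigroup : a (Fin.last k) ∈ semigroup a :=
  AddSubmonoid.subset_closure ⟨_, rfl⟩

lemma last_mem_semigroup_dual : a (Fin.last k) ∈ semigroup (dualSeq a) :=
  AddSubmonoid.subset_closure ⟨Fin.last k, by simp [dualSeq]⟩

lemma sub_mem_semigroup_dual (i : Fin (k + 1)) :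
    a (Fin.last k) - a i ∈ semigroup (dualSeq a) := by
  by_cases hi : i = Fin.last k
  · subst hi
    simp
  · exact AddSubmonoid.subset_closure ⟨i, by simp [dualSeq, hi]⟩

lemma mem_of_mem_projSemigroup (hlast : ∀ i, i ≠ Fin.last k → a i < a (Fin.last k)) {w : ℕ × ℕ}
    (hw : w ∈ projSemigroup a) :
    w.1 ∈ semigroup a ∧ w.2 ∈ semigroup (dualSeq a) ∧ a (Fin.last k) ∣ w.1 + w.2 := by
  induction hw using AddSubmonoid.closure_induction with
  | mem w hw =>
    rcases hw with rfl | ⟨i, rfl⟩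
    · exact ⟨zero_mem _, last_mem_semigroup_dual, by simp⟩
    · refine ⟨AddSubmonoid.subset_closure ⟨i, rfl⟩, sub_mem_semigroup_dual i, ?_⟩
      simp [Nat.add_sub_cancel' (le_last hlast i)]
  | zero => exact ⟨zero_mem _, zero_mem _, by simp⟩
  | add v w _ _ hv hw =>
    refine ⟨add_mem hv.1 hw.1, add_mem hv.2.1 hw.2.1, ?_⟩
    have := dvd_add hv.2.2 hw.2.2
    rwa [add_add_add_comm] at this

lemma exists_snd_of_mem_semigroup {x : ℕ} (hx : x ∈ semigroup a) :
    ∃ y, (x, y) ∈ projSemigroup a := by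
  induction hx using AddSubmonoid.closure_induction with
  | mem x hx =>
    obtain ⟨i, rfl⟩ := hx
    exact ⟨_, gen_mem i⟩
  | zero => exact ⟨0, zero_mem _⟩
  | add v w _ _ hv hw =>
    obtain ⟨y, hy⟩ := hv
    obtain ⟨z, hz⟩ := hw
    exact ⟨y + z, by simpa using add_mem hy hz⟩

lemma exists_fst_of_mem_semigroup_dual {y : ℕ} (hy : y ∈ semigroup (dualSeq a)) :
    ∃ x, (x, y) ∈ projSemigroup a := by
  induction hy using AddSubmonoid.closure_induction with
  | mem x hx =>
    obtain ⟨i, rfl⟩ := hx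
    by_cases hi : i = Fin.last k
    · exact ⟨0, by simpa [dualSeq, hi] using axis_snd_mem⟩
    · exact ⟨a i, by simpa [dualSeq, hi] using gen_mem i⟩
  | zero => exact ⟨0, zero_mem _⟩
  | add v w _ _ hv hw =>
    obtain ⟨y, hy⟩ := hv
    obtain ⟨z, hz⟩ := hw
    exact ⟨y + z, by simpa using add_mem hy hz⟩

/-- Congruent natural numbers differ by a multiple of the modulus. -/
lemma exists_eq_add_mul_of_dvd {d x x' y : ℕ} (h : d ∣ x + y) (h' : d ∣ x' + y) (hle : x' ≤ x) :
    ∃ n, x = x' + n * d := by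
  have h3 : d ∣ (x + y) - (x' + y) := Nat.dvd_sub h h'
  obtain ⟨n, hn⟩ := h3
  exact ⟨n, by rw [mul_comm n d]; omega⟩

lemma exists_shift_snd_mem (hlast : ∀ i, i ≠ Fin.last k → a i < a (Fin.last k))
    (hd : 0 < a (Fin.last k)) {x y : ℕ} (hx : x ∈ semigroup a) (hxy : a (Fin.last k) ∣ x + y) :
    ∃ n, (x, y + n * a (Fin.last k)) ∈ projSemigroup a := by
  obtain ⟨z, hz⟩ := exists_snd_of_mem_semigroup hx
  have hdz := (mem_of_mem_projSemigroup hlast hz).2.2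
  -- Since `aₙ > 0`, shifting by `z * aₙ` brings the second coordinate up to at least `z`.
  refine ⟨z, ?_⟩
  have hle : z ≤ y + z * a (Fin.last k) := (Nat.le_mul_of_pos_right z hd).trans (Nat.le_add_left _ _)
  have h1 : a (Fin.last k) ∣ (y + z * a (Fin.last k)) + x := by
    have := dvd_add hxy (Dvd.intro_left z rfl)
    rwa [add_comm x y, add_right_comm] at this
  obtain ⟨n, hn⟩ := exists_eq_add_mul_of_dvd h1 (by simpa [add_comm] using hdz) hle
  rw [hn]
  simpa using add_mem hz (nsmul_axis_snd_mem n)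

lemma exists_shift_fst_mem (hlast : ∀ i, i ≠ Fin.last k → a i < a (Fin.last k))
    (hd : 0 < a (Fin.last k)) {x y : ℕ} (hy : y ∈ semigroup (dualSeq a))
    (hxy : a (Fin.last k) ∣ x + y) :
    ∃ n, (x + n * a (Fin.last k), y) ∈ projSemigroup a := by
  obtain ⟨z, hz⟩ := exists_fst_of_mem_semigroup_dual hy
  have hdz := (mem_of_mem_projSemigroup hlast hz).2.2
  refine ⟨z, ?_⟩
  have hle : z ≤ x + z * a (Fin.last k) := (Nat.le_mul_of_pos_right z hd).trans (Nat.le_add_left _ _)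
  have h1 : a (Fin.last k) ∣ (x + z * a (Fin.last k)) + y := by
    have := dvd_add hxy (Dvd.intro_left z rfl)
    rwa [add_right_comm] at this
  obtain ⟨n, hn⟩ := exists_eq_add_mul_of_dvd h1 hdz hle
  rw [hn]
  simpa using add_mem hz (nsmul_axis_fst_mem n)

/-- The least element of a residue class of a semigroup lies in the Apéry set. -/
lemma exists_apery_le (G : AddSubmonoid ℕ) {d x y : ℕ} (hd : 0 < d) (hx : x ∈ G)
    (hxy : d ∣ x + y) : ∃ ν ∈ aperySet G d, d ∣ ν + y ∧ ν ≤ x := by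
  classical
  have hex : ∃ z, z ∈ G ∧ d ∣ z + y := ⟨x, hx, hxy⟩
  refine ⟨Nat.find hex, ⟨(Nat.find_spec hex).1, fun z hz hzd => ?_⟩, (Nat.find_spec hex).2,
    Nat.find_min' hex ⟨hx, hxy⟩⟩
  have h1 : d ∣ z + y := by
    have h2 := (Nat.find_spec hex).2
    rw [← hzd, show z + d + y = (z + y) + d by ring] at h2
    exact (Nat.dvd_add_left (dvd_refl d)).1 h2
  have := Nat.find_min' hex ⟨hz, h1⟩
  omega

/-- A smaller `x` in the class would give `ν = x + (n + 1) * d`, and `ν - d` would lie in `G`. The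
residue class is recorded by `y`, as that of `-y`. -/
lemma apery_le {G : AddSubmonoid ℕ} {d ν x y : ℕ} (hdG : d ∈ G) (hν : ν ∈ aperySet G d)
    (hνy : d ∣ ν + y) (hx : x ∈ G) (hxy : d ∣ x + y) : ν ≤ x := by
  by_contra hlt
  obtain ⟨n, hn⟩ := exists_eq_add_mul_of_dvd hνy hxy (by omega)
  rcases n with _ | n
  · simp at hn
    omega
  · refine hν.2 (x + n * d) ?_ (by rw [hn]; ring)
    simpa using add_mem hx (G.nsmul_mem hdG n)

theorem aperySetIsGood_iff (hlast : ∀ i, i ≠ Fin.last k → a i < a (Fin.last k))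
    (hd : 0 < a (Fin.last k)) :
    AperySetIsGood a ↔ ∀ x ∈ semigroup a, ∀ y ∈ semigroup (dualSeq a),
      a (Fin.last k) ∣ x + y → (x, y) ∈ projSemigroup a := by
  constructor
  · intro hgood x hx y hy hxy
    obtain ⟨ν, hν, hνy, hνx⟩ := exists_apery_le (semigroup a) hd hx hxy
    obtain ⟨μ, hμ, hμν, hμy⟩ := exists_apery_le (semigroup (dualSeq a)) (y := ν) hd hy
      (by rwa [add_comm])
    -- Goodness makes `μ` a partner of some Apéry element `ν'`. It is congruent to `ν`, and an Apéry
    -- set has one element per class, so `ν' = ν`.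
    have key : (ν, μ) ∈ projSemigroup a := by
      have h1 := hμ
      rw [← hgood] at h1
      rcases h1 with rfl | ⟨ν', hν', -, hmin⟩
      · have : ν ≤ 0 := apery_le (y := 0) last_mem_semigroup hν (by simpa using hμν)
          (zero_mem _) (by simp)
        obtain rfl : ν = 0 := by omega
        exact zero_mem _
      · have h2 := (mem_of_mem_projSemigroup hlast hmin.1.2).2.2
        have h3 : ν ≤ ν' := apery_le last_mem_semigroup hν (by rwa [add_comm]) hν'.1 h2
        have h4 : ν' ≤ ν := apery_le last_mem_semigroup hν' h2 hν.1 (by rwa [add_comm])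
        rw [le_antisymm h3 h4]
        exact hmin.1.2
    obtain ⟨p, hp⟩ := exists_eq_add_mul_of_dvd hxy hνy hνx
    obtain ⟨q, hq⟩ := exists_eq_add_mul_of_dvd (by rwa [add_comm] : _ ∣ y + ν) hμν hμy
    rw [hp, hq]
    simpa using add_mem key (add_mem (nsmul_axis_fst_mem p) (nsmul_axis_snd_mem q))
  · intro hsat
    apply Set.Subset.antisymm
    · rintro μ (rfl | ⟨ν, hν, -, hmin⟩)
      · exact ⟨zero_mem _, fun y _ => by omega⟩
      · refine ⟨hmin.1.1, fun y hy hyd => ?_⟩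
        have h1 := (mem_of_mem_projSemigroup hlast hmin.1.2).2.2
        have h2 : a (Fin.last k) ∣ ν + y := by
          simp only [← hyd, ← add_assoc] at h1
          exact (Nat.dvd_add_left (dvd_refl _)).1 h1
        have := hmin.2 ⟨hy, hsat ν hν.1 y hy h2⟩
        omega
    · intro y hy
      rcases Nat.eq_zero_or_pos y with rfl | hy0
      · exact Set.mem_insert _ _
      right
      obtain ⟨x, hx⟩ := exists_fst_of_mem_semigroup_dual hy.1
      obtain ⟨hxH, -, hxy⟩ := mem_of_mem_projSemigroup hlast hx
      obtain ⟨ν, hν, hνy, -⟩ := exists_apery_le (semigroup a) hd hxH hxy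
      refine ⟨ν, hν, ?_, ⟨hy.1, hsat ν hν.1 y hy.1 hνy⟩, ?_⟩
      · rintro rfl
        have := apery_le (y := 0) last_mem_semigroup_dual hy (by simpa [add_comm] using hνy)
          (zero_mem _) (by simp)
        omega
      · rintro z ⟨hz, hzS⟩
        have h1 := (mem_of_mem_projSemigroup hlast hzS).2.2
        exact apery_le (y := ν) last_mem_semigroup_dual hy (by rwa [add_comm]) hz
          (by rwa [add_comm])

end Combinatorics

end MonomialCurve

/-! ### Spans of monomials in two variables and division inside them. -/

namespace MonomialCurve

open Polynomial

section Bivariate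

variable (K : Type*) [Field K]

/-- The basis of monomials of the polynomial ring in two variables, viewed as `K[X][X]`. -/
noncomputable def bimon : Module.Basis (ℕ × ℕ) K K[X][X] :=
  (Polynomial.basisMonomials K).smulTower (Polynomial.basisMonomials K[X])

lemma bimon_apply (w : ℕ × ℕ) : bimon K w = C (X ^ w.1) * X ^ w.2 := by
  simp [bimon, Module.Basis.smulTower_apply, Polynomial.monomial_one_right_eq_X_pow,
    Polynomial.smul_eq_C_mul]

lemma bimon_zero : bimon K 0 = 1 := by simp [bimon_apply]

lemma bimon_add (v w : ℕ × ℕ) : bimon K (v + w) = bimon K v * bimon K w := by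
  simp only [bimon_apply, Prod.fst_add, Prod.snd_add, pow_add, C_mul]
  ring

lemma bimon_nsmul (n : ℕ) (w : ℕ × ℕ) : bimon K (n • w) = bimon K w ^ n := by
  simp only [bimon_apply, Prod.smul_fst, Prod.smul_snd, smul_eq_mul, mul_comm n, pow_mul, map_pow,
    mul_pow]

/-- The span of the monomials with exponent in a given set. -/
noncomputable def monSpan (P : Set (ℕ × ℕ)) : Submodule K K[X][X] :=
  Submodule.span K (bimon K '' P)

variable {K}

lemma bimon_mem_monSpan {P : Set (ℕ × ℕ)} {w : ℕ × ℕ} : bimon K w ∈ monSpan K P ↔ w ∈ P := by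
  rw [monSpan, Module.Basis.mem_span_image, Module.Basis.repr_self]
  simp

lemma monSpan_disjoint_compl (P : Set (ℕ × ℕ)) : Disjoint (monSpan K P) (monSpan K Pᶜ) :=
  (bimon K).linearIndependent.disjoint_span_image disjoint_compl_right

lemma monSpan_sup_compl (P : Set (ℕ × ℕ)) : monSpan K P ⊔ monSpan K Pᶜ = ⊤ := by
  rw [monSpan, monSpan, ← Submodule.span_union, ← Set.image_union, Set.union_compl_self,
    Set.image_univ, (bimon K).span_eq]

lemma bimon_mul_mem_monSpan {P : Set (ℕ × ℕ)} {v : ℕ × ℕ} (hP : ∀ w ∈ P, v + w ∈ P) {c : K[X][X]}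
    (hc : c ∈ monSpan K P) : bimon K v * c ∈ monSpan K P := by
  induction hc using Submodule.span_induction with
  | mem c hc =>
    obtain ⟨w, hw, rfl⟩ := hc
    rw [← bimon_add, bimon_mem_monSpan]
    exact hP w hw
  | zero => simp
  | add c e _ _ hc he => rw [mul_add]; exact add_mem hc he
  | smul r c _ hc => rw [mul_smul_comm]; exact Submodule.smul_mem _ _ hc

lemma aeval_mul_mem {T : Type*} [CommRing T] [Algebra K T] {M : Submodule K T} {z : T}
    (hz : ∀ c ∈ M, z * c ∈ M) (g : K[X]) {c : T} (hc : c ∈ M) : aeval z g * c ∈ M := by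
  induction g using Polynomial.induction_on' with
  | add p q hp hq => rw [map_add, add_mul]; exact add_mem hp hq
  | monomial n r =>
    rw [aeval_monomial, mul_assoc, ← Algebra.smul_def]
    apply Submodule.smul_mem
    induction n with
    | zero => simpa
    | succ n ih => rw [pow_succ', mul_assoc]; exact hz _ ih

/-- A set of exponents closed under translation by `v` in both directions gives a space of
polynomials closed under division by polynomials in the corresponding monomial. -/
lemma mem_monSpan_of_aeval_mul_mem {P : Set (ℕ × ℕ)} {v : ℕ × ℕ} (hP : ∀ w, v + w ∈ P ↔ w ∈ P)
    {g : K[X]} (hg : aeval (bimon K v) g ≠ 0) {c : K[X][X]}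
    (hc : aeval (bimon K v) g * c ∈ monSpan K P) : c ∈ monSpan K P := by
  -- Multiplication preserves both the span of `P` and that of its complement, so the product with
  -- `c₂` lies in both and vanishes; then `c₂ = 0` in a domain.
  obtain ⟨c₁, h₁, c₂, h₂, rfl⟩ := Submodule.mem_sup.1
    ((monSpan_sup_compl (K := K) P).symm ▸ Submodule.mem_top : c ∈ monSpan K P ⊔ monSpan K Pᶜ)
  have m₁ := aeval_mul_mem (fun c => bimon_mul_mem_monSpan fun w => (hP w).2) g h₁
  have m₂ := aeval_mul_mem
    (fun c => bimon_mul_mem_monSpan (P := Pᶜ) (v := v) fun w hw h => hw ((hP w).1 h)) g h₂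
  rw [mul_add] at hc
  have h0 := Submodule.disjoint_def.1 (monSpan_disjoint_compl P) _
    ((Submodule.add_mem_iff_right _ m₁).1 hc) m₂
  rcases mul_eq_zero.1 h0 with h | rfl
  · exact absurd h hg
  · simpa using h₁

lemma monic_aeval_snd {d : ℕ} (hd : 0 < d) {g : K[X]} (hg : g.Monic) :
    (aeval (bimon K (0, d)) g).Monic := by
  have h : aeval (bimon K (0, d)) g = (expand K d g).map C := by
    rw [bimon_apply]
    clear hg
    induction g using Polynomial.induction_on' with
    | add p q hp hq => simp_all
    | monomial n r =>
      simp [← C_mul_X_pow_eq_monomial, ← pow_mul]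
  rw [h]
  exact (hg.expand hd).map C

lemma aeval_fst {d : ℕ} (g : K[X]) :
    aeval (bimon K (d, 0)) g = C (expand K d g) := by
  rw [bimon_apply]
  induction g using Polynomial.induction_on' with
  | add p q hp hq => simp_all
  | monomial n r =>
    simp [← C_mul_X_pow_eq_monomial, ← pow_mul]

lemma aeval_fst_ne_zero {d : ℕ} (hd : 0 < d) {g : K[X]} (hg : g ≠ 0) :
    aeval (bimon K (d, 0)) g ≠ 0 := by
  rw [aeval_fst, Ne, C_eq_zero]
  exact (expand_ne_zero hd).2 hg

/-- A monic polynomial is a nonzerodivisor modulo a constant polynomial. -/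
lemma C_dvd_of_C_dvd_monic_mul {A : Type*} [CommRing A] {r : A} {h c : A[X]} (hh : h.Monic)
    (hdvd : C r ∣ h * c) : C r ∣ c := by
  have key : ∀ p : A[X], C r ∣ p ↔ p.map (Ideal.Quotient.mk (Ideal.span {r})) = 0 := by
    intro p
    rw [C_dvd_iff_dvd_coeff, Polynomial.ext_iff]
    simp [Ideal.Quotient.eq_zero_iff_dvd]
  rw [key] at hdvd ⊢
  rw [Polynomial.map_mul] at hdvd
  exact (hh.map _).mul_right_eq_zero_iff.1 hdvd

end Bivariate

/-! ### The monomial parametrization and its image. -/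

section Map

variable (K : Type*) [Field K] {k : ℕ} (a : Fin (k + 1) → ℕ)

/-- The exponents of the monomials parametrizing the projective monomial curve. -/
def projExp : Fin (k + 2) → ℕ × ℕ :=
  Fin.cons (0, a (Fin.last k)) fun i => (a i, a (Fin.last k) - a i)

/-- The parametrization of the projective monomial curve. -/
noncomputable def projMap : MvPolynomial (Fin (k + 2)) K →ₐ[K] K[X][X] :=
  MvPolynomial.aeval fun i => bimon K (projExp a i)

variable {a}

lemma projExp_mem (i : Fin (k + 2)) : projExp a i ∈ projSemigroup a := by
  refine Fin.cases ?_ (fun j => ?_) i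
  · exact axis_snd_mem
  · exact gen_mem j

/-- The exponent of the image of a monomial. -/
def monExp (a : Fin (k + 1) → ℕ) (β : Fin (k + 2) →₀ ℕ) : ℕ × ℕ :=
  ∑ i, β i • projExp a i

lemma monExp_mem (β : Fin (k + 2) →₀ ℕ) : monExp a β ∈ projSemigroup a :=
  sum_mem fun i _ => AddSubmonoid.nsmul_mem _ (projExp_mem i) _

lemma monExp_zero : monExp a 0 = 0 := by simp [monExp]

lemma monExp_add (β γ : Fin (k + 2) →₀ ℕ) : monExp a (β + γ) = monExp a β + monExp a γ := by
  simp [monExp, add_smul, Finset.sum_add_distrib]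

lemma monExp_single (i : Fin (k + 2)) : monExp a (Finsupp.single i 1) = projExp a i := by
  simp [monExp, Finsupp.single_apply, ite_smul]

lemma exists_monExp_eq {w : ℕ × ℕ} (hw : w ∈ projSemigroup a) : ∃ β, monExp a β = w := by
  induction hw using AddSubmonoid.closure_induction with
  | mem w hw =>
    rcases hw with rfl | ⟨i, rfl⟩
    · exact ⟨Finsupp.single 0 1, by rw [monExp_single]; rfl⟩
    · exact ⟨Finsupp.single i.succ 1, by rw [monExp_single]; rfl⟩
  | zero => exact ⟨0, monExp_zero⟩
  | add v w _ _ hv hw =>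
    obtain ⟨β, rfl⟩ := hv
    obtain ⟨γ, rfl⟩ := hw
    exact ⟨β + γ, monExp_add β γ⟩

lemma bimon_sum {ι : Type*} (s : Finset ι) (f : ι → ℕ × ℕ) :
    bimon K (∑ i ∈ s, f i) = ∏ i ∈ s, bimon K (f i) := by
  classical
  induction s using Finset.induction_on with
  | empty => simp [bimon_zero]
  | insert i s hi ih => rw [Finset.sum_insert hi, Finset.prod_insert hi, bimon_add, ih]

lemma projMap_monomial (β : Fin (k + 2) →₀ ℕ) (r : K) :
    projMap K a (MvPolynomial.monomial β r) = r • bimon K (monExp a β) := by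
  rw [projMap, MvPolynomial.aeval_monomial, Algebra.smul_def, monExp, bimon_sum,
    Finsupp.prod_fintype _ _ fun i => pow_zero _]
  simp_rw [bimon_nsmul]

lemma range_projMap :
    LinearMap.range (projMap K a).toLinearMap = monSpan K (projSemigroup a : Set (ℕ × ℕ)) := by
  apply le_antisymm
  · rintro _ ⟨F, rfl⟩
    induction F using MvPolynomial.induction_on' with
    | monomial β r =>
      rw [AlgHom.toLinearMap_apply, projMap_monomial]
      exact Submodule.smul_mem _ _ (bimon_mem_monSpan.2 (monExp_mem β))
    | add p q hp hq => rw [map_add]; exact add_mem hp hq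
  · rw [monSpan, Submodule.span_le]
    rintro _ ⟨w, hw, rfl⟩
    obtain ⟨β, rfl⟩ := exists_monExp_eq hw
    exact ⟨MvPolynomial.monomial β 1, by simp [projMap_monomial]⟩

end Map

end MonomialCurve

/-! ### The homogeneous ideal as the kernel of the parametrization. -/

namespace MonomialCurve

open Polynomial

section Homogenization

variable {K : Type*} [Field K] {k : ℕ} {a : Fin (k + 1) → ℕ}

lemma monExp_cons (c : ℕ) (α : Fin (k + 1) →₀ ℕ) :
    monExp a (Finsupp.cons c α) = (∑ i, α i * a i,
      c * a (Fin.last k) + ∑ i, α i * (a (Fin.last k) - a i)) := by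
  rw [monExp, Fin.sum_univ_succ]
  simp only [Finsupp.cons_zero, Finsupp.cons_succ, projExp, Fin.cons_zero, Fin.cons_succ]
  ext
  · simp [Prod.fst_sum]
  · simp [Prod.snd_sum]

lemma sum_add_sum_eq (hlast : ∀ i, i ≠ Fin.last k → a i < a (Fin.last k))
    (α : Fin (k + 1) →₀ ℕ) :
    ∑ i, α i * a i + ∑ i, α i * (a (Fin.last k) - a i) = α.degree * a (Fin.last k) := by
  rw [← Finset.sum_add_distrib, Finsupp.degree_eq_sum, Finset.sum_mul]
  refine Finset.sum_congr rfl fun i _ => ?_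
  rw [← mul_add, Nat.add_sub_cancel' (le_last hlast i)]

lemma aeval_pow_eq_sum (f : MvPolynomial (Fin (k + 1)) K) :
    MvPolynomial.aeval (R := K) (fun i => (X : K[X]) ^ a i) f =
      ∑ α ∈ f.support, f.coeff α • (X : K[X]) ^ (∑ i, α i * a i) := by
  rw [MvPolynomial.aeval_def, MvPolynomial.eval₂_eq']
  refine Finset.sum_congr rfl fun α _ => ?_
  rw [Algebra.smul_def, ← Finset.prod_pow_eq_pow_sum]
  simp_rw [← pow_mul, mul_comm]

lemma mem_toricIdeal {f : MvPolynomial (Fin (k + 1)) K} :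
    f ∈ toricIdeal K a ↔ MvPolynomial.aeval (R := K) (fun i => (X : K[X]) ^ a i) f = 0 :=
  Iff.rfl

lemma projMap_homogenizePoly (hlast : ∀ i, i ≠ Fin.last k → a i < a (Fin.last k))
    {f : MvPolynomial (Fin (k + 1)) K} (hf : f ∈ toricIdeal K a) :
    projMap K a (homogenizePoly f) = 0 := by
  -- With the total degree fixed, the image of a homogenized monomial depends only on its power of
  -- `t`. Hence the image of the homogenization is a linear function of `f(t ^ a₁, …, t ^ aₙ)`,
  -- which is zero.
  let L : K[X] →ₗ[K] K[X][X] := (Polynomial.basisMonomials K).constr K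
    fun n => bimon K (n, f.totalDegree * a (Fin.last k) - n)
  have hL : ∀ n : ℕ, L (X ^ n) = bimon K (n, f.totalDegree * a (Fin.last k) - n) := by
    intro n
    have := (Polynomial.basisMonomials K).constr_basis K
      (fun n => bimon K (n, f.totalDegree * a (Fin.last k) - n)) n
    rw [Polynomial.coe_basisMonomials] at this
    rwa [← Polynomial.monomial_one_right_eq_X_pow]
  have h0 : L (∑ α ∈ f.support, f.coeff α • (X : K[X]) ^ (∑ i, α i * a i)) = 0 := by
    rw [← aeval_pow_eq_sum, mem_toricIdeal.1 hf, map_zero]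
  rw [← h0, homogenizePoly, map_sum, map_sum]
  refine Finset.sum_congr rfl fun α hα => ?_
  rw [projMap_monomial, map_smul, hL, monExp_cons]
  congr 3
  have h1 := sum_add_sum_eq hlast α
  have h2 : α.degree ≤ f.totalDegree := MvPolynomial.le_totalDegree hα
  obtain ⟨e, he⟩ := Nat.exists_eq_add_of_le h2
  rw [he, Nat.add_sub_cancel_left, add_mul, ← h1]
  omega

lemma homogenizeIdeal_le_ker (hlast : ∀ i, i ≠ Fin.last k → a i < a (Fin.last k)) :
    homogenizeIdeal (toricIdeal K a) ≤ RingHom.ker (projMap K a) := by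
  rw [homogenizeIdeal, Ideal.span_le]
  rintro _ ⟨f, hf, rfl⟩
  exact projMap_homogenizePoly hlast hf

lemma homogenizePoly_binomial {m : ℕ} {α γ : Fin m →₀ ℕ} (h : α ≠ γ) :
    ∃ D, α.degree ≤ D ∧ γ.degree ≤ D ∧ D ≤ max α.degree γ.degree ∧
      homogenizePoly (MvPolynomial.monomial α (1 : K) - MvPolynomial.monomial γ 1) =
        MvPolynomial.monomial (Finsupp.cons (D - α.degree) α) 1 -
          MvPolynomial.monomial (Finsupp.cons (D - γ.degree) γ) 1 := by
  classical
  set f := MvPolynomial.monomial α (1 : K) - MvPolynomial.monomial γ 1 with hf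
  have hα : f.coeff α = 1 := by simp [hf, MvPolynomial.coeff_monomial, h.symm]
  have hγ : f.coeff γ = -1 := by simp [hf, MvPolynomial.coeff_monomial, h]
  refine ⟨f.totalDegree, MvPolynomial.le_totalDegree (by simp [hα]),
    MvPolynomial.le_totalDegree (by simp [hγ]), ?_, ?_⟩
  · refine (MvPolynomial.totalDegree_sub _ _).trans (le_of_eq ?_)
    rw [MvPolynomial.totalDegree_monomial _ one_ne_zero,
      MvPolynomial.totalDegree_monomial _ one_ne_zero]
    rfl
  · have hsub : f.support ⊆ {α, γ} := by
      refine (MvPolynomial.support_sub _ _ _).trans ?_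
      exact Finset.union_subset_union MvPolynomial.support_monomial_subset
        MvPolynomial.support_monomial_subset
    rw [homogenizePoly, Finset.sum_subset hsub fun β _ hβ => by
      rw [MvPolynomial.notMem_support_iff.1 hβ, map_zero], Finset.sum_pair h, hα, hγ, map_neg,
      sub_eq_add_neg]

lemma single_add_cons {m : ℕ} (n c : ℕ) (α : Fin m →₀ ℕ) :
    Finsupp.single 0 n + Finsupp.cons c α = Finsupp.cons (n + c) α := by
  ext i
  refine Fin.cases ?_ (fun j => ?_) i
  · simp
  · simp

/-- The coordinate sum of the exponent is `aₙ` times the degree, so both monomials have the same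
degree. Their difference is then a power of `x₀` times the homogenization of an affine binomial; the
bound on `D` by the larger affine degree makes that power nonnegative. -/
lemma monomial_sub_monomial_mem (hlast : ∀ i, i ≠ Fin.last k → a i < a (Fin.last k))
    (hd : 0 < a (Fin.last k)) {β γ : Fin (k + 2) →₀ ℕ} (h : monExp a β = monExp a γ) :
    MvPolynomial.monomial β (1 : K) - MvPolynomial.monomial γ 1 ∈
      homogenizeIdeal (toricIdeal K a) := by
  obtain ⟨b, α, rfl⟩ : ∃ b α, β = Finsupp.cons b α := ⟨β 0, β.tail, (Finsupp.cons_tail β).symm⟩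
  obtain ⟨c, δ, rfl⟩ : ∃ c δ, γ = Finsupp.cons c δ := ⟨γ 0, γ.tail, (Finsupp.cons_tail γ).symm⟩
  rw [monExp_cons, monExp_cons, Prod.mk.injEq] at h
  have hα := sum_add_sum_eq hlast α
  have hδ := sum_add_sum_eq hlast δ
  have hdeg : b + α.degree = c + δ.degree := by
    apply Nat.eq_of_mul_eq_mul_right hd
    rw [add_mul, add_mul, ← hα, ← hδ]
    omega
  by_cases hne : α = δ
  · subst hne
    obtain rfl : b = c := by omega
    simp
  obtain ⟨D, h1, h2, h3, h4⟩ := homogenizePoly_binomial (K := K) hne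
  have hmem : homogenizePoly (MvPolynomial.monomial α (1 : K) - MvPolynomial.monomial δ 1) ∈
      homogenizeIdeal (toricIdeal K a) := by
    refine Ideal.subset_span ⟨_, ?_, rfl⟩
    rw [SetLike.mem_coe, mem_toricIdeal, map_sub, MvPolynomial.aeval_monomial, MvPolynomial.aeval_monomial,
      Finsupp.prod_fintype _ _ fun i => pow_zero _, Finsupp.prod_fintype _ _ fun i => pow_zero _]
    simp_rw [← pow_mul, mul_comm (a _), Finset.prod_pow_eq_pow_sum]
    rw [h.1, sub_self]
  have := Ideal.mul_mem_left _ (MvPolynomial.monomial (Finsupp.single 0 (b + α.degree - D)) (1 : K))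
    hmem
  rw [h4, mul_sub, MvPolynomial.monomial_mul, MvPolynomial.monomial_mul, single_add_cons,
    single_add_cons, one_mul] at this
  convert this using 5 <;> omega

theorem homogenizeIdeal_toricIdeal (hlast : ∀ i, i ≠ Fin.last k → a i < a (Fin.last k))
    (hd : 0 < a (Fin.last k)) :
    homogenizeIdeal (toricIdeal K a) = RingHom.ker (projMap K a) := by
  refine le_antisymm (homogenizeIdeal_le_ker hlast) fun F hF => ?_
  have hex : ∀ w : ℕ × ℕ, ∃ β : Fin (k + 2) →₀ ℕ, w ∈ projSemigroup a → monExp a β = w := by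
    intro w
    by_cases hw : w ∈ projSemigroup a
    · obtain ⟨β, hβ⟩ := exists_monExp_eq hw
      exact ⟨β, fun _ => hβ⟩
    · exact ⟨0, fun h => absurd h hw⟩
  choose σ hσ using hex
  let q := Ideal.Quotient.mkₐ K (homogenizeIdeal (toricIdeal K a))
  -- Modulo the homogenized ideal a monomial depends only on its exponent, so the quotient map
  -- factors through `projMap`. Values of `σ` outside the semigroup play no role.
  let ρ : K[X][X] →ₗ[K] MvPolynomial (Fin (k + 2)) K ⧸ homogenizeIdeal (toricIdeal K a) :=
    (bimon K).constr K fun w => q (MvPolynomial.monomial (σ w) 1)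
  have hρ : ∀ G, ρ (projMap K a G) = q G := by
    intro G
    induction G using MvPolynomial.induction_on' with
    | add p q hp hq => rw [map_add, map_add, map_add, hp, hq]
    | monomial β r =>
      rw [projMap_monomial, map_smul, Module.Basis.constr_basis, ← map_smul]
      rw [show MvPolynomial.monomial β r = r • MvPolynomial.monomial β (1 : K) by
        rw [MvPolynomial.smul_monomial, smul_eq_mul, mul_one], map_smul, map_smul]
      congr 1
      exact Ideal.Quotient.eq.2 (monomial_sub_monomial_mem hlast hd (hσ _ (monExp_mem β)))
  apply Ideal.Quotient.eq_zero_iff_mem.1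
  have := hρ F
  rw [RingHom.mem_ker.1 hF, map_zero] at this
  exact this.symm

end Homogenization

end MonomialCurve

/-! ### Depth bounds for localizations. -/

section Depth

open RingTheory.Sequence

lemma isSMulRegular_quotSMulTop_iff {R : Type*} [CommRing R] {r s : R} :
    IsSMulRegular (QuotSMulTop r R) s ↔ ∀ c, r ∣ s * c → r ∣ c := by
  rw [isSMulRegular_quotient_iff_mem_of_smul_mem]
  simp only [Submodule.mem_smul_pointwise_iff_exists, Submodule.mem_top, true_and, smul_eq_mul,
    dvd_def, eq_comm]

/-- If some element that is not divisible by `b` is multiplied into the multiples of `b` by the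
whole maximal ideal, then the depth is at most one. -/
lemma localDepth_le_one {R : Type*} [CommRing R] [IsDomain R] [IsLocalRing R] {a b : R}
    (hb : b ≠ 0) (hab : ¬ b ∣ a) (h : ∀ r ∈ IsLocalRing.maximalIdeal R, b ∣ r * a) :
    localDepth R ≤ 1 := by
  refine iSup_le ?_
  rintro ⟨rs, hreg, hmem⟩
  rcases rs with _ | ⟨r, _ | ⟨s, rs⟩⟩
  · simp
  · simp
  exfalso
  rw [isRegular_cons_iff, isRegular_cons_iff] at hreg
  obtain ⟨hr, hs, -⟩ := hreg
  obtain ⟨c, hc⟩ := h r (hmem r (by simp))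
  obtain ⟨e, he⟩ := h s (hmem s (by simp))
  have hr0 : r ≠ 0 := by
    rintro rfl
    exact IsSMulRegular.not_zero_iff.2 inferInstance hr
  -- From `r * a = b * c` and `s * a = b * e`, cancelling `b` gives `s * c = r * e`. Regularity
  -- yields `c = r * f`, hence `a = b * f`.
  obtain ⟨f, hf⟩ := isSMulRegular_quotSMulTop_iff.1 hs c
    ⟨e, mul_left_cancel₀ hb (by linear_combination -s * hc + r * he)⟩
  exact hab ⟨f, mul_left_cancel₀ hr0 (by rw [hc, hf]; ring)⟩

lemma localDepth_localization_le_one {R : Type*} [CommRing R] [IsDomain R] {p : Ideal R}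
    [hp : p.IsMaximal] {a b : R} (hb : b ≠ 0) (hab : ¬ b ∣ a) (h : ∀ r ∈ p, b ∣ r * a) :
    localDepth (Localization.AtPrime p) ≤ 1 := by
  have hinj : Function.Injective (algebraMap R (Localization.AtPrime p)) :=
    IsLocalization.injective _ p.primeCompl_le_nonZeroDivisors
  have : IsDomain (Localization.AtPrime p) :=
    IsLocalization.isDomain_localization p.primeCompl_le_nonZeroDivisors
  refine localDepth_le_one (a := algebraMap R _ a) (b := algebraMap R _ b)
    (by rwa [Ne, map_eq_zero_iff _ hinj]) ?_ ?_
  · rintro ⟨c, hc⟩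
    obtain ⟨c, s, rfl⟩ := IsLocalization.exists_mk'_eq p.primeCompl c
    have h1 : (s : R) * a = b * c := by
      apply hinj
      rw [map_mul, map_mul, hc, mul_left_comm, IsLocalization.mk'_spec']
    -- Maximality gives `1 = u * s + v` with `v ∈ p`; since `b` divides both `s * a` and `v * a`, it
    -- divides `a`.
    obtain ⟨u, v, hv, huv⟩ := hp.exists_inv s.2
    obtain ⟨e, he⟩ := h v hv
    exact hab ⟨u * c + e, by linear_combination -a * huv + u * h1 + he⟩
  · intro r hr
    obtain ⟨r, s, rfl⟩ := IsLocalization.exists_mk'_eq p.primeCompl r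
    obtain ⟨e, he⟩ := h r ((IsLocalization.AtPrime.mk'_mem_maximal_iff _ p r s).1 hr)
    exact ⟨IsLocalization.mk' _ e s, by
      rw [mul_comm, IsLocalization.mul_mk'_eq_mk'_of_mul, IsLocalization.mul_mk'_eq_mk'_of_mul,
        mul_comm, he]⟩

lemma localDepth_localization_le_height {R : Type*} [CommRing R] [IsNoetherianRing R]
    (p : Ideal R) [p.IsPrime] : localDepth (Localization.AtPrime p) ≤ p.height := by
  refine iSup_le ?_
  rintro ⟨rs, hreg, -⟩
  have h := ringKrullDim_add_length_eq_ringKrullDim_of_isRegular rs hreg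
  rw [IsLocalization.AtPrime.ringKrullDim_eq_height p (Localization.AtPrime p)] at h
  have : Nontrivial (Localization.AtPrime p ⧸ Ideal.ofList rs) :=
    Ideal.Quotient.nontrivial_iff.2 fun h => hreg.2 (by simp [h])
  have h1 := add_le_add_left (ringKrullDim_nonneg_of_nontrivial
    (R := Localization.AtPrime p ⧸ Ideal.ofList rs)) (rs.length : WithBot ℕ∞)
  rw [h, zero_add] at h1
  exact_mod_cast h1

/-- A local ring of height at most two with a regular sequence of length two is
Cohen-Macaulay. -/
lemma isCohenMacaulayLocalRing_of_regular_pair {R : Type*} [CommRing R] [IsNoetherianRing R]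
    [IsDomain R] {p : Ideal R} [p.IsPrime] (hp : p.height ≤ 2) {r s : R} (hr : r ∈ p) (hs : s ∈ p)
    (hr0 : r ≠ 0) (hreg : ∀ c, r ∣ s * c → r ∣ c) :
    IsCohenMacaulayLocalRing (Localization.AtPrime p) := by
  refine ⟨inferInstance, ?_⟩
  rw [IsLocalization.AtPrime.ringKrullDim_eq_height p (Localization.AtPrime p)]
  refine congrArg _ (le_antisymm (localDepth_localization_le_height p) (hp.trans ?_))
  have hw : IsWeaklyRegular R [r, s] := by
    rw [isWeaklyRegular_cons_iff, isWeaklyRegular_cons_iff]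
    exact ⟨IsSMulRegular.of_ne_zero hr0, isSMulRegular_quotSMulTop_iff.2 hreg, .nil _ _⟩
  have hreg' := hw.isRegular_of_isLocalization_of_mem (Localization.AtPrime p) p (by simp [hr, hs])
  refine le_iSup_of_le ⟨_, hreg', ?_⟩ (by simp)
  simp only [List.map_cons, List.map_nil, List.mem_cons, List.not_mem_nil, or_false,
    forall_eq_or_imp, forall_eq]
  exact ⟨(IsLocalization.AtPrime.to_map_mem_maximal_iff _ p r).2 hr,
    (IsLocalization.AtPrime.to_map_mem_maximal_iff _ p s).2 hs⟩

end Depth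

/-! ### The vertex of the cone: Cohen-Macaulay implies saturated. -/

namespace MonomialCurve

open Polynomial

section Coordinate

variable {K : Type*} [Field K] {k : ℕ} {a : Fin (k + 1) → ℕ} {R : Type*} [CommRing R] [Algebra K R]
  {ψ : R →ₐ[K] K[X][X]} {x : Fin (k + 2) → R}

lemma constantCoeff_bimon (w : ℕ × ℕ) :
    constantCoeff (bimon K w) = if w.2 = 0 then X ^ w.1 else 0 := by
  have h : constantCoeff (C (X ^ w.1 : K[X])) = X ^ w.1 := coeff_C_zero
  rw [bimon_apply, map_mul, h, map_pow, constantCoeff_apply, coeff_X_zero, zero_pow_eq]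
  split <;> simp

lemma pow_last_eq (hψ : Function.Injective ψ) (hx : ∀ i, ψ (x i) = bimon K (projExp a i)) (i : Fin (k + 1)) :
    x i.succ ^ a (Fin.last k) = x (Fin.last _) ^ a i * x 0 ^ (a (Fin.last k) - a i) := by
  apply hψ
  rw [map_mul, map_pow, map_pow, map_pow, hx, hx, hx, ← bimon_nsmul, ← bimon_nsmul, ← bimon_nsmul,
    ← bimon_add, ← Fin.succ_last]
  simp [projExp, mul_comm]

lemma mem_of_axes_mem (hd : 0 < a (Fin.last k)) (hψ : Function.Injective ψ)
    (hx : ∀ i, ψ (x i) = bimon K (projExp a i)) {p : Ideal R} (hp : p.IsPrime) (h0 : x 0 ∈ p)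
    (h1 : x (Fin.last _) ∈ p) (i : Fin (k + 2)) : x i ∈ p := by
  refine Fin.cases h0 (fun j => ?_) i
  apply hp.mem_of_pow_mem (a (Fin.last k))
  rw [pow_last_eq hψ hx]
  rcases Nat.eq_zero_or_pos (a j) with h | h
  · exact p.mul_mem_left _ (p.pow_mem_of_mem h0 _ (by omega))
  · exact p.mul_mem_right _ (p.pow_mem_of_mem h1 _ h)

/-- The evaluation at the vertex of the affine cone. -/
noncomputable def vertexEval (ψ : R →ₐ[K] K[X][X]) : R →+* K :=
  (constantCoeff.comp constantCoeff).comp ψ.toRingHom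

/-- The restriction to the ray of the affine cone on which the first coordinate vanishes. -/
noncomputable def rayEval (ψ : R →ₐ[K] K[X][X]) : R →+* K[X] :=
  constantCoeff.comp ψ.toRingHom

lemma vertexEval_algebraMap (r : K) : vertexEval ψ (algebraMap K R r) = r := by
  have : ψ (algebraMap K R r) = C (C r) := ψ.commutes r
  simp [vertexEval, this]

lemma vertexEval_coord (hlast : ∀ i, i ≠ Fin.last k → a i < a (Fin.last k))
    (hd : 0 < a (Fin.last k)) (hx : ∀ i, ψ (x i) = bimon K (projExp a i)) (i : Fin (k + 2)) :
    vertexEval ψ (x i) = 0 := by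
  have h : vertexEval ψ (x i) = constantCoeff (constantCoeff (ψ (x i))) := rfl
  rw [h, hx, constantCoeff_bimon]
  refine Fin.cases ?_ (fun j => ?_) i
  · simp [projExp, hd.ne']
  · have := le_last hlast j
    rcases Nat.eq_zero_or_pos (a j) with h | h
    · simp [projExp, h, hd.ne']
    · simp only [projExp, Fin.cons_succ]
      split
      · rw [map_pow, constantCoeff_apply, coeff_X_zero, zero_pow h.ne']
      · exact map_zero _

lemma vertexEval_surjective : Function.Surjective (vertexEval ψ) := fun r =>
  ⟨_, vertexEval_algebraMap r⟩

/-- Modulo `p` every generator agrees with its value at the vertex, hence so does every element. -/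
lemma ker_vertexEval_le (hlast : ∀ i, i ≠ Fin.last k → a i < a (Fin.last k))
    (hd : 0 < a (Fin.last k)) (hx : ∀ i, ψ (x i) = bimon K (projExp a i))
    (hadj : Algebra.adjoin K (Set.range x) = ⊤) {p : Ideal R} (hp : ∀ i, x i ∈ p) :
    RingHom.ker (vertexEval ψ) ≤ p := by
  have key : ∀ r : R, r - algebraMap K R (vertexEval ψ r) ∈ p := by
    intro r
    have hr : r ∈ Algebra.adjoin K (Set.range x) := hadj ▸ Algebra.mem_top
    induction hr using Algebra.adjoin_induction with
    | mem r hr =>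
      obtain ⟨i, rfl⟩ := hr
      simpa [vertexEval_coord hlast hd hx] using hp i
    | algebraMap r => simp [vertexEval_algebraMap]
    | add r s _ _ hr hs =>
      have := add_mem hr hs
      rw [map_add, map_add]
      convert this using 1
      ring
    | mul r s _ _ hr hs =>
      have := add_mem (p.mul_mem_left r hs) (p.mul_mem_right (algebraMap K R (vertexEval ψ s)) hr)
      rw [map_mul, map_mul]
      convert this using 1
      ring
  intro r hr
  have := key r
  rwa [RingHom.mem_ker.1 hr, map_zero, sub_zero] at this

/-- The chain is zero, the ideal of a ray, the ideal of the vertex; `x₀` shows the first inclusion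
strict and `xₙ` the second. -/
lemma two_le_height (hlast : ∀ i, i ≠ Fin.last k → a i < a (Fin.last k))
    (hd : 0 < a (Fin.last k)) (hψ : Function.Injective ψ)
    (hx : ∀ i, ψ (x i) = bimon K (projExp a i)) : 2 ≤ (RingHom.ker (vertexEval ψ)).height := by
  have : IsDomain R := hψ.isDomain ψ.toRingHom
  have h0 : x 0 ∈ RingHom.ker (rayEval ψ) := by
    have h : rayEval ψ (x 0) = constantCoeff (ψ (x 0)) := rfl
    rw [RingHom.mem_ker, h, hx, constantCoeff_bimon]
    simp [projExp, hd.ne']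
  have h1 : x (Fin.last _) ∉ RingHom.ker (rayEval ψ) := by
    have h : rayEval ψ (x (Fin.last _)) = constantCoeff (ψ (x (Fin.last _))) := rfl
    rw [RingHom.mem_ker, h, hx, constantCoeff_bimon, ← Fin.succ_last]
    simp [projExp]
  have hlt₁ : (⊥ : Ideal R) < RingHom.ker (rayEval ψ) := by
    refine bot_lt_iff_ne_bot.2 fun h => ?_
    rw [h, Ideal.mem_bot] at h0
    have h2 := hx 0
    rw [h0, map_zero] at h2
    exact (bimon K).ne_zero _ h2.symm
  have hlt₂ : RingHom.ker (rayEval ψ) < RingHom.ker (vertexEval ψ) := by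
    refine lt_of_le_of_ne (fun r hr => ?_) fun h => h1 (h ▸ vertexEval_coord hlast hd hx _)
    have h : vertexEval ψ r = constantCoeff (rayEval ψ r) := rfl
    rw [RingHom.mem_ker, h, RingHom.mem_ker.1 hr, map_zero]
  have : (RingHom.ker (rayEval ψ)).IsPrime := RingHom.ker_isPrime _
  have : (RingHom.ker (vertexEval ψ)).IsPrime := RingHom.ker_isPrime _
  have e₁ := Ideal.height_add_one_le_of_lt_of_isPrime hlt₁
  have e₂ := Ideal.height_add_one_le_of_lt_of_isPrime hlt₂
  calc (2 : ℕ∞) = 0 + 1 + 1 := by norm_num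
    _ ≤ (⊥ : Ideal R).height + 1 + 1 := by gcongr; exact zero_le
    _ ≤ (RingHom.ker (rayEval ψ)).height + 1 := by gcongr
    _ ≤ _ := e₂

theorem mem_projSemigroup_of_isCohenMacaulayRing
    (hlast : ∀ i, i ≠ Fin.last k → a i < a (Fin.last k))
    (hd : 0 < a (Fin.last k)) (hψ : Function.Injective ψ)
    (hx : ∀ i, ψ (x i) = bimon K (projExp a i)) (hadj : Algebra.adjoin K (Set.range x) = ⊤)
    (hrange : LinearMap.range ψ.toLinearMap = monSpan K (projSemigroup a : Set (ℕ × ℕ)))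
    (hCM : IsCohenMacaulayRing R) {u v : ℕ} (hu : u ∈ semigroup a)
    (hv : v ∈ semigroup (dualSeq a)) (huv : a (Fin.last k) ∣ u + v) :
    (u, v) ∈ projSemigroup a := by
  by_contra hS
  have : IsNoetherianRing R := hCM.1
  have : IsDomain R := hψ.isDomain ψ.toRingHom
  obtain ⟨n, hn⟩ := exists_shift_snd_mem hlast hd hu huv
  obtain ⟨m, hm⟩ := exists_shift_fst_mem hlast hd hv huv
  have hlift : ∀ w ∈ projSemigroup a, ∃ r, ψ r = bimon K w := fun w hw => by
    have h : bimon K w ∈ LinearMap.range ψ.toLinearMap := hrange.symm ▸ bimon_mem_monSpan.2 hw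
    exact h
  obtain ⟨s, hs⟩ := hlift _ hm
  obtain ⟨t, ht⟩ := hlift _ hn
  set b := x (Fin.last _) ^ m with hb
  have hψb : ψ b = bimon K (m * a (Fin.last k), 0) := by
    rw [hb, map_pow, hx, ← bimon_nsmul, ← Fin.succ_last]
    simp [projExp]
  have hb0 : b ≠ 0 := by
    intro h
    rw [h, map_zero] at hψb
    exact (bimon K).ne_zero _ hψb.symm
  have hbs : ¬ b ∣ s := by
    rintro ⟨c, rfl⟩
    have h1 : bimon K (m * a (Fin.last k), 0) * ψ c =
        bimon K (m * a (Fin.last k), 0) * bimon K (u, v) := by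
      rw [← hψb, ← map_mul, hs, hψb, ← bimon_add]
      simp [add_comm]
    have h2 := mul_left_cancel₀ ((bimon K).ne_zero _) h1
    have h3 : bimon K (u, v) ∈ monSpan K (projSemigroup a : Set (ℕ × ℕ)) :=
      hrange ▸ ⟨c, h2⟩
    exact hS (bimon_mem_monSpan.1 h3)
  have hbt : x 0 ^ n * s = b * t := by
    apply hψ
    rw [map_mul, map_mul, map_pow, hx, hs, ht, hψb, ← bimon_nsmul, ← bimon_add, ← bimon_add]
    simp [projExp, add_comm]
  have hs0 : (Ideal.Quotient.mk (Ideal.span {b}) s) ≠ 0 := by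
    rwa [Ne, Ideal.Quotient.eq_zero_iff_dvd]
  -- The annihilator of `s` modulo `b` contains `x₀ ^ n` and `b = xₙ ^ m`, so the associated prime
  -- `P` contains the vertex ideal. Its witness `c` then satisfies the hypotheses of the depth
  -- bound.
  obtain ⟨P, hP, hle⟩ := exists_le_isAssociatedPrime_of_isNoetherianRing R _ hs0
  obtain ⟨hprime, c, hc⟩ := isAssociatedPrime_iff.1 hP
  obtain ⟨c, rfl⟩ := Ideal.Quotient.mk_surjective c
  have hmem : ∀ r e, r ∈ (⊥ : Submodule R (R ⧸ Ideal.span {b})).colon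
      {Ideal.Quotient.mk (Ideal.span {b}) e} ↔ b ∣ r * e := by
    intro r e
    rw [Submodule.mem_colon_singleton, Submodule.mem_bot, ← Ideal.Quotient.eq_zero_iff_dvd, map_mul]
    rfl
  have h0 : x 0 ∈ P := hprime.mem_of_pow_mem n (hle ((hmem _ _).2 ⟨t, hbt⟩))
  have h1 : x (Fin.last _) ∈ P := hprime.mem_of_pow_mem m (hle ((hmem _ _).2 ⟨s, rfl⟩))
  have hmax : (RingHom.ker (vertexEval ψ)).IsMaximal :=
    RingHom.ker_isMaximal_of_surjective _ vertexEval_surjective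
  have hker : RingHom.ker (vertexEval ψ) ≤ P :=
    ker_vertexEval_le hlast hd hx hadj (mem_of_axes_mem hd hψ hx hprime h0 h1)
  have hbc : ¬ b ∣ c := fun h => hprime.ne_top <| (Ideal.eq_top_iff_one _).2 <| by
    rw [hc, hmem, one_mul]
    exact h
  have hdepth := localDepth_localization_le_one (p := RingHom.ker (vertexEval ψ)) hb0 hbc
    fun r hr => (hmem r c).1 (hc ▸ hker hr)
  have hdim := (hCM.2 (RingHom.ker (vertexEval ψ))).2
  rw [IsLocalization.AtPrime.ringKrullDim_eq_height (RingHom.ker (vertexEval ψ))] at hdim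
  have hdim' := WithBot.coe_injective hdim
  rw [hdim'] at hdepth
  have := (two_le_height hlast hd hψ hx).trans hdepth
  exact absurd this (by norm_num)

end Coordinate

end MonomialCurve

/-! ### Saturated implies Cohen-Macaulay. -/

namespace MonomialCurve

open Polynomial

section Converse

variable {K : Type*} [Field K] {k : ℕ} {a : Fin (k + 1) → ℕ} {R : Type*} [CommRing R] [Algebra K R]
  {ψ : R →ₐ[K] K[X][X]} {x : Fin (k + 2) → R}

lemma mem_monSpan_inter {P Q : Set (ℕ × ℕ)} {c : K[X][X]} (hP : c ∈ monSpan K P)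
    (hQ : c ∈ monSpan K Q) : c ∈ monSpan K (P ∩ Q) := by
  rw [monSpan, Module.Basis.mem_span_image] at *
  exact Set.subset_inter hP hQ

lemma monSpan_mono {P Q : Set (ℕ × ℕ)} (h : P ⊆ Q) : monSpan K P ≤ monSpan K Q :=
  Submodule.span_mono (Set.image_mono h)

/-- If the semigroup of the projective curve is saturated, then polynomials in the two axis
coordinates form a regular sequence. -/
lemma dvd_of_dvd_aeval_mul (hlast : ∀ i, i ≠ Fin.last k → a i < a (Fin.last k))
    (hd : 0 < a (Fin.last k)) (hψ : Function.Injective ψ)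
    (hx : ∀ i, ψ (x i) = bimon K (projExp a i))
    (hrange : LinearMap.range ψ.toLinearMap = monSpan K (projSemigroup a : Set (ℕ × ℕ)))
    (hsat : ∀ u ∈ semigroup a, ∀ v ∈ semigroup (dualSeq a),
      a (Fin.last k) ∣ u + v → (u, v) ∈ projSemigroup a)
    {g h : K[X]} (hg : g ≠ 0) (hh : h.Monic) {c : R}
    (hdvd : aeval (x (Fin.last _)) g ∣ aeval (x 0) h * c) : aeval (x (Fin.last _)) g ∣ c := by
  have hψg : ψ (aeval (x (Fin.last _)) g) = aeval (bimon K (a (Fin.last k), 0)) g := by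
    rw [← Polynomial.aeval_algHom_apply, hx, ← Fin.succ_last]
    simp [projExp]
  have hψh : ψ (aeval (x 0) h) = aeval (bimon K (0, a (Fin.last k))) h := by
    rw [← Polynomial.aeval_algHom_apply, hx]
    rfl
  have hmem : ∀ r, ψ r ∈ monSpan K (projSemigroup a : Set (ℕ × ℕ)) := fun r => hrange ▸ ⟨r, rfl⟩
  have hg0 := aeval_fst_ne_zero hd hg
  have hh1 := monic_aeval_snd hd hh
  obtain ⟨e, he⟩ := hdvd
  have he' := congrArg ψ he
  rw [map_mul, map_mul, hψg, hψh] at he'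
  -- In `K[X][X]` the image of `g(xₙ)` is a constant and that of `h(x₀)` is monic, so the division
  -- works there; it remains to show that `f` comes from `R`.
  obtain ⟨f, hf⟩ : aeval (bimon K (a (Fin.last k), 0)) g ∣ ψ c := by
    rw [aeval_fst] at he' ⊢
    exact C_dvd_of_C_dvd_monic_mul hh1 ⟨_, he'⟩
  have hfe : aeval (bimon K (0, a (Fin.last k))) h * f = ψ e := by
    apply mul_left_cancel₀ hg0
    rw [← he', hf]
    ring
  -- Dividing by `g(xₙ)` keeps control of second coordinates, as translation by `(aₙ, 0)` fixes
  -- them; dividing by `h(x₀)` does the same for first coordinates. Saturation combines the two.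
  have hf₁ : f ∈ monSpan K {w : ℕ × ℕ | w.2 ∈ semigroup (dualSeq a) ∧
      a (Fin.last k) ∣ w.1 + w.2} := by
    refine mem_monSpan_of_aeval_mul_mem (v := (a (Fin.last k), 0)) (fun w => ?_) hg0
      (monSpan_mono (fun w hw => (mem_of_mem_projSemigroup hlast hw).2) (hf ▸ hmem c))
    simp [add_assoc]
  have hf₂ : f ∈ monSpan K {w : ℕ × ℕ | w.1 ∈ semigroup a ∧
      a (Fin.last k) ∣ w.1 + w.2} := by
    refine mem_monSpan_of_aeval_mul_mem (v := (0, a (Fin.last k))) (fun w => ?_) hh1.ne_zero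
      (monSpan_mono (fun w hw => ?_) (hfe ▸ hmem e))
    · simp only [Set.mem_ofPred_eq, Prod.fst_add, Prod.snd_add, zero_add]
      rw [add_left_comm, Nat.dvd_add_right (dvd_refl _)]
    · have := mem_of_mem_projSemigroup hlast hw
      exact ⟨this.1, this.2.2⟩
  have hf₃ : f ∈ LinearMap.range ψ.toLinearMap :=
    hrange ▸ monSpan_mono (fun w hw => hsat _ hw.2.1 _ hw.1.1 hw.1.2) (mem_monSpan_inter hf₁ hf₂)
  obtain ⟨r, rfl⟩ := hf₃
  refine ⟨r, hψ ?_⟩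
  rw [hf, map_mul, hψg]
  rfl

/-- A prime ideal containing a nonconstant polynomial in each of the two axis coordinates is
maximal. -/
lemma isMaximal_of_aeval_mem (hd : 0 < a (Fin.last k)) (hψ : Function.Injective ψ)
    (hx : ∀ i, ψ (x i) = bimon K (projExp a i)) (hadj : Algebra.adjoin K (Set.range x) = ⊤)
    {g h : K[X]} (hg : g.Monic) (hh : h.Monic) {q : Ideal R} [q.IsPrime]
    (hgq : aeval (x (Fin.last _)) g ∈ q) (hhq : aeval (x 0) h ∈ q) : q.IsMaximal := by
  let π := Ideal.Quotient.mkₐ K q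
  have hint : ∀ y : R, ∀ f : K[X], f.Monic → aeval y f ∈ q → IsIntegral K (π y) := by
    intro y f hf hy
    refine ⟨f, hf, ?_⟩
    rw [← aeval_def, Polynomial.aeval_algHom_apply]
    exact Ideal.Quotient.eq_zero_iff_mem.2 hy
  have h0 := hint _ h hh hhq
  have h1 := hint _ g hg hgq
  have hxi : ∀ i, IsIntegral K (π (x i)) := by
    intro i
    refine Fin.cases h0 (fun j => ?_) i
    refine IsIntegral.of_pow hd ?_
    rw [← map_pow, pow_last_eq hψ hx, map_mul, map_pow, map_pow]
    exact (h1.pow _).mul (h0.pow _)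
  have hall : ∀ y : R, IsIntegral K (π y) := by
    intro y
    have hy : y ∈ Algebra.adjoin K (Set.range x) := hadj ▸ Algebra.mem_top
    induction hy using Algebra.adjoin_induction with
    | mem y hy => obtain ⟨i, rfl⟩ := hy; exact hxi i
    | algebraMap r => rw [AlgHom.commutes]; exact isIntegral_algebraMap
    | add y z _ _ hy hz => rw [map_add]; exact hy.add hz
    | mul y z _ _ hy hz => rw [map_mul]; exact hy.mul hz
  have : Algebra.IsIntegral K (R ⧸ q) := ⟨fun y => by
    obtain ⟨y, rfl⟩ := Ideal.Quotient.mk_surjective y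
    exact hall y⟩
  exact Ideal.Quotient.maximal_of_isField _
    (isField_of_isIntegral_of_isField' (Field.toIsField K))

theorem isCohenMacaulayRing_of_saturated [Algebra.FiniteType K R]
    (hlast : ∀ i, i ≠ Fin.last k → a i < a (Fin.last k))
    (hd : 0 < a (Fin.last k)) (hψ : Function.Injective ψ)
    (hx : ∀ i, ψ (x i) = bimon K (projExp a i)) (hadj : Algebra.adjoin K (Set.range x) = ⊤)
    (hrange : LinearMap.range ψ.toLinearMap = monSpan K (projSemigroup a : Set (ℕ × ℕ)))
    (hsat : ∀ u ∈ semigroup a, ∀ v ∈ semigroup (dualSeq a),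
      a (Fin.last k) ∣ u + v → (u, v) ∈ projSemigroup a) : IsCohenMacaulayRing R := by
  have : IsNoetherianRing R := Algebra.FiniteType.isNoetherianRing K R
  have : IsDomain R := hψ.isDomain ψ.toRingHom
  refine ⟨inferInstance, fun p hp => ?_⟩
  let _ : Field (R ⧸ p) := Ideal.Quotient.field p
  have : Algebra.FiniteType K (R ⧸ p) := inferInstance
  have : Module.Finite K (R ⧸ p) := finite_of_finite_type_of_isJacobsonRing K (R ⧸ p)
  -- By the Nullstellensatz the residue field is finite over `K`, so each residue is a root of a
  -- monic polynomial.
  have hex : ∀ y : R, ∃ f : K[X], f.Monic ∧ aeval y f ∈ p := by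
    intro y
    obtain ⟨f, hf, hfy⟩ := Algebra.IsIntegral.isIntegral (R := K) (Ideal.Quotient.mkₐ K p y)
    refine ⟨f, hf, Ideal.Quotient.eq_zero_iff_mem.1 ?_⟩
    rw [← aeval_def, Polynomial.aeval_algHom_apply] at hfy
    exact hfy
  obtain ⟨g, hg, hgp⟩ := hex (x (Fin.last _))
  obtain ⟨h, hh, hhp⟩ := hex (x 0)
  refine isCohenMacaulayLocalRing_of_regular_pair ?_ hgp hhp ?_ fun c =>
    dvd_of_dvd_aeval_mul hlast hd hψ hx hrange hsat hg.ne_zero hh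
  -- Every prime containing both polynomials is maximal, so `p` is minimal over them and Krull's
  -- height theorem applies.
  · have hmin : p ∈ (Ideal.span {aeval (x (Fin.last _)) g, aeval (x 0) h}).minimalPrimes := by
      refine ⟨⟨hp.isPrime, ?_⟩, fun q hq hqp => ?_⟩
      · rw [Ideal.span_le]
        rintro _ (rfl | rfl)
        · exact hgp
        · exact hhp
      · have := hq.1
        have hqmax := isMaximal_of_aeval_mem hd hψ hx hadj hg hh
          (hq.2 (Ideal.subset_span (by simp))) (hq.2 (Ideal.subset_span (by simp)))
        exact (hqmax.eq_of_le hp.ne_top hqp).ge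
    refine (Ideal.height_le_card_of_mem_minimalPrimes_span (Set.toFinite _) hmin).trans ?_
    have h2 := Set.ncard_insert_le (aeval (x (Fin.last _)) g) {aeval (x 0) h}
    rw [Set.ncard_singleton] at h2
    exact_mod_cast h2
  · intro h0
    have h1 := congrArg ψ h0
    rw [← Polynomial.aeval_algHom_apply, hx, ← Fin.succ_last, map_zero] at h1
    exact aeval_fst_ne_zero hd hg.ne_zero (by simpa [projExp] using h1)

end Converse

end MonomialCurve

theorem corollary2p7 (K : Type*) [Field K] (k : ℕ) (a : Fin (k + 1) → ℕ)
    (hgcd : Finset.univ.gcd a = 1)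
    (hlast : ∀ i, i ≠ Fin.last k → a i < a (Fin.last k)) :
    MonomialCurve.IsArithmeticallyCohenMacaulay K a ↔ MonomialCurve.AperySetIsGood a := by
  have hd := MonomialCurve.last_pos hgcd hlast
  have hI := MonomialCurve.homogenizeIdeal_toricIdeal (K := K) hlast hd
  rw [MonomialCurve.aperySetIsGood_iff hlast hd, MonomialCurve.IsArithmeticallyCohenMacaulay,
    IsCohenMacaulayIdeal, hI]
  let φ := MonomialCurve.projMap K a
  let ψ := Ideal.kerLiftAlg φ
  let x : Fin (k + 2) → MvPolynomial (Fin (k + 2)) K ⧸ RingHom.ker φ :=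
    fun i => Ideal.Quotient.mkₐ K _ (MvPolynomial.X i)
  have hψ : Function.Injective ψ := Ideal.kerLiftAlg_injective φ
  have hψmk : ∀ F, ψ (Ideal.Quotient.mkₐ K _ F) = φ F := fun F => Ideal.kerLiftAlg_mk φ F
  have hx : ∀ i, ψ (x i) = MonomialCurve.bimon K (MonomialCurve.projExp a i) := fun i =>
    (hψmk _).trans (MvPolynomial.aeval_X _ i)
  have hadj : Algebra.adjoin K (Set.range x) = ⊤ := by
    have h : Set.range x = Ideal.Quotient.mkₐ K (RingHom.ker φ) '' Set.range MvPolynomial.X := by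
      rw [← Set.range_comp]
      rfl
    rw [h, ← AlgHom.map_adjoin, MvPolynomial.adjoin_range_X, Algebra.map_top,
      AlgHom.range_eq_top]
    exact Ideal.Quotient.mkₐ_surjective K _
  have hrange : LinearMap.range ψ.toLinearMap =
      MonomialCurve.monSpan K (MonomialCurve.projSemigroup a : Set (ℕ × ℕ)) := by
    rw [← MonomialCurve.range_projMap]
    ext t
    constructor
    · rintro ⟨r, rfl⟩
      obtain ⟨F, rfl⟩ := Ideal.Quotient.mkₐ_surjective K _ r
      exact ⟨F, (hψmk F).symm⟩
    · rintro ⟨F, rfl⟩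
      exact ⟨_, hψmk F⟩
  constructor
  · intro hCM u hu v hv huv
    exact MonomialCurve.mem_projSemigroup_of_isCohenMacaulayRing hlast hd hψ hx hadj hrange hCM
      hu hv huv
  · intro hsat
    have : Algebra.FiniteType K (MvPolynomial (Fin (k + 2)) K ⧸ RingHom.ker φ) := inferInstance
    exact MonomialCurve.isCohenMacaulayRing_of_saturated hlast hd hψ hx hadj hrange hsat
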